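/- Let $d\ge 2$, $n\ge 1$, and let $\Omega\subset\mathbb{R}^d$ be an open polyhedral domain with a simplicial partition $\triangle$: a finite simplicial complex in $\mathbb R^d$ in which every face lies in a $d$-dimensional simplex, and whose union is $\overline\Omega$. "Simplex of $\triangle$" means (closed) $d$-dimensional simplex of $\triangle$. Let $S^0_n(\triangle)$ be the space of continuous functions on $\overline\Omega$ that coincide on each simplex of $\triangle$ with a polynomial of total degree at most $n$ (extended by zero outside $\overline\Omega$). Let $\mathcal W=H^1_0(\Omega)\cap S^0_n(\triangle)$ with $$\langle f,g\rangle_{\mathcal W}=\int_\Omega\nabla f\cdot\nabla g,\qquad \|f\|_{\mathcal W}=\Big(\int_\Omega|\nabla f|^2\Big)^{1/2},\qquad \|f\cdot\chi_T\|_{\mathcal W}:=\Big(\int_{\Omega\cap T}|\nabla f|^2\Big)^{1/2}$$ for a simplex $T$ of $\triangle$. For a set (cluster) $\omega$ of simplices of $\triangle$ put $\mathrm{star}^0(\omega)=\omega$ and let $\mathrm{star}^{k+1}(\omega)$ be the set of all simplices of $\triangle$ that intersect some simplex of $\mathrm{star}^k(\omega)$; we also write $\mathrm{star}^k(\omega)$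 for the union of these simplices, and $\mathrm{star}^k(T)=\mathrm{star}^k(\{T\})$. Suppose that $\mathcal W$ has a (finite) basis $\{\mathcal B_\xi\}_{\xi\in\mathcal M}$ that is $1$-local, i.e. for each $\xi\in\mathcal M$ there is a simplex $T_\xi$ of $\triangle$ with $\operatorname{supp}\mathcal B_\xi\subseteq \mathrm{star}^1(T_\xi)$, and that satisfies, with constants $C_1,C_2>0$, $$C_1\sum_{\xi\in\mathcal M}|c_\xi|^2\le\Big\|\sum_{\xi\in\mathcal M}c_\xi\mathcal B_\xi\Big\|_{\mathcal W}^2\le C_2\sum_{\xi\in\mathcal M}|c_\xi|^2$$ for all real coefficients $(c_\xi)_{\xi\in\mathcal M}$. Then there are constants $\sigma\in(0,1)$ and $C>0$, depending only on the ratio $C_2/C_1$ (in particular not on $d$, $n$, $\Omega$, $\triangle$, the basis, $\omega$, $T$, $k$ or $g$), such that the following holds. Let $\omega$ be a set of simplices of $\triangle$, let $T\in\omega$, and let $k\ge1$. If $g\in\mathcal W$ satisfies $$\langle g,w\rangle_{\mathcal W}=0\quad\text{for all } w\in\mathcal W\text{ with }\operatorname{supp}(w)\subseteq\mathrm{star}^k(\omega),$$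 then $$\|g\cdot\chi_T\|_{\mathcal W}\le C\,\sigma^k\,\|g\|_{\mathcal W}.$$ -/

import Mathlib

open MeasureTheory Filter Topology

noncomputable section

/-! ### The Sobolev space of functions vanishing on the boundary, and the energy inner product -/

/-- `φ` is a test function on `Ω`: smooth, with compact support contained in `Ω`. -/
structure IsTestFunction {d : ℕ} (Ω : Set (EuclideanSpace ℝ (Fin d)))
    (φ : EuclideanSpace ℝ (Fin d) → ℝ) : Prop where
  contDiff : ContDiff ℝ ((⊤ : ℕ∞) : WithTop ℕ∞) φ
  hasCompactSupport : HasCompactSupport φ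
  tsupport_subset : tsupport φ ⊆ Ω

/-- `u` and `G` are square integrable on `Ω`, and `G` is the weak gradient of `u` on `Ω`. -/
structure HasWeakGradient {d : ℕ} (Ω : Set (EuclideanSpace ℝ (Fin d)))
    (u : EuclideanSpace ℝ (Fin d) → ℝ)
    (G : EuclideanSpace ℝ (Fin d) → EuclideanSpace ℝ (Fin d)) : Prop where
  memLp : MemLp u 2 (volume.restrict Ω)
  memLp_grad : MemLp G 2 (volume.restrict Ω)
  integral_eq : ∀ φ : EuclideanSpace ℝ (Fin d) → ℝ, IsTestFunction Ω φ →
    ∫ x in Ω, u x • gradient φ x = - ∫ x in Ω, φ x • G x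

open Classical in
/-- The weak gradient of `u` on `Ω` (determined almost everywhere on `Ω` if `Ω` is open and
`u ∈ H¹(Ω)`, and zero if `u ∉ H¹(Ω)`). -/
def weakGradient {d : ℕ} (Ω : Set (EuclideanSpace ℝ (Fin d)))
    (u : EuclideanSpace ℝ (Fin d) → ℝ) : EuclideanSpace ℝ (Fin d) → EuclideanSpace ℝ (Fin d) :=
  if h : ∃ G, HasWeakGradient Ω u G then h.choose else 0

/-- `u ∈ H¹₀(Ω)`: `u` lies in `H¹(Ω)` and is a limit of test functions on `Ω` in the
`H¹(Ω)`-norm. -/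
def MemH10 {d : ℕ} (Ω : Set (EuclideanSpace ℝ (Fin d)))
    (u : EuclideanSpace ℝ (Fin d) → ℝ) : Prop :=
  ∃ G, HasWeakGradient Ω u G ∧
    ∃ φ : ℕ → EuclideanSpace ℝ (Fin d) → ℝ, (∀ j, IsTestFunction Ω (φ j)) ∧
      Tendsto (fun j => eLpNorm (fun x => φ j x - u x) 2 (volume.restrict Ω)) atTop (𝓝 0) ∧
      Tendsto (fun j => eLpNorm (fun x => gradient (φ j) x - G x) 2 (volume.restrict Ω))
        atTop (𝓝 0)

/-- The energy inner product `⟨∇f, ∇g⟩` of `L²(Ω)`. -/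
def energyInner {d : ℕ} (Ω : Set (EuclideanSpace ℝ (Fin d)))
    (f g : EuclideanSpace ℝ (Fin d) → ℝ) : ℝ :=
  ∫ x in Ω, inner ℝ (weakGradient Ω f x) (weakGradient Ω g x)

/-- The energy norm `‖∇f‖` of `L²(Ω)`. -/
def energyNorm {d : ℕ} (Ω : Set (EuclideanSpace ℝ (Fin d)))
    (f : EuclideanSpace ℝ (Fin d) → ℝ) : ℝ :=
  Real.sqrt (energyInner Ω f f)

/-- The energy norm of `f · χ_A`, that is, the `L²(Ω)`-norm of `χ_A ∇f`. -/
def energyNormOn {d : ℕ} (Ω A : Set (EuclideanSpace ℝ (Fin d)))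
    (f : EuclideanSpace ℝ (Fin d) → ℝ) : ℝ :=
  Real.sqrt (∫ x in Ω, ‖A.indicator (weakGradient Ω f) x‖ ^ 2)

/-! ### Simplicial partitions and stars -/

/-- `K` is a (finite, conforming) simplicial partition of the open set `Ω ⊆ ℝᵈ` into
`d`-dimensional simplices and their faces. -/
structure IsSimplicialPartition {d : ℕ}
    (K : Geometry.SimplicialComplex ℝ (EuclideanSpace ℝ (Fin d)))
    (Ω : Set (EuclideanSpace ℝ (Fin d))) : Prop where
  isOpen : IsOpen Ω
  finite : K.faces.Finite
  pure : ∀ s ∈ K.faces, ∃ t ∈ K.faces, s ⊆ t ∧ t.card = d + 1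
  space_eq : K.space = closure Ω

/-- The `d`-dimensional simplices of the partition, each given by its vertices. -/
def simplices {d : ℕ} (K : Geometry.SimplicialComplex ℝ (EuclideanSpace ℝ (Fin d))) :
    Set (Finset (EuclideanSpace ℝ (Fin d))) :=
  {T | T ∈ K.faces ∧ T.card = d + 1}

/-- The simplex with vertex set `T`, as a closed set of points. -/
def simplexSet {d : ℕ} (T : Finset (EuclideanSpace ℝ (Fin d))) :
    Set (EuclideanSpace ℝ (Fin d)) :=
  convexHull ℝ (T : Set (EuclideanSpace ℝ (Fin d)))

/-- The simplices of `star^k(ω)` for a cluster `ω` of simplices: `star^0(ω) = ω`, and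
`star^(k+1)(ω)` consists of all simplices which touch a simplex of `star^k(ω)`. -/
def starCluster {d : ℕ} (K : Geometry.SimplicialComplex ℝ (EuclideanSpace ℝ (Fin d)))
    (ω : Set (Finset (EuclideanSpace ℝ (Fin d)))) :
    ℕ → Set (Finset (EuclideanSpace ℝ (Fin d)))
  | 0 => ω
  | k + 1 => {T | T ∈ simplices K ∧
      ∃ t ∈ starCluster K ω k, (simplexSet T ∩ simplexSet t).Nonempty}

/-- `star^k(ω)` as a set of points: the union of its simplices. -/
def starSet {d : ℕ} (K : Geometry.SimplicialComplex ℝ (EuclideanSpace ℝ (Fin d)))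
    (ω : Set (Finset (EuclideanSpace ℝ (Fin d)))) (k : ℕ) : Set (EuclideanSpace ℝ (Fin d)) :=
  ⋃ T ∈ starCluster K ω k, simplexSet T

/-! ### Splines -/

/-- The space of continuous splines of degree `n`: functions which are continuous on the union of
the simplices and agree on each simplex with a polynomial of total degree at most `n`. They are
extended by zero to all of `ℝᵈ`. -/
def splineSpace {d : ℕ} (K : Geometry.SimplicialComplex ℝ (EuclideanSpace ℝ (Fin d))) (n : ℕ) :
    Submodule ℝ (EuclideanSpace ℝ (Fin d) → ℝ) where
  carrier := {u | ContinuousOn u K.space ∧ (∀ x, x ∉ K.space → u x = 0) ∧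
    ∀ T ∈ simplices K, ∃ p : MvPolynomial (Fin d) ℝ, p.totalDegree ≤ n ∧
      ∀ x ∈ simplexSet T, u x = MvPolynomial.eval (fun i => x i) p}
  add_mem' := by
    rintro u v ⟨hu1, hu2, hu3⟩ ⟨hv1, hv2, hv3⟩
    refine ⟨hu1.add hv1, fun x hx => by simp [hu2 x hx, hv2 x hx], fun T hT => ?_⟩
    obtain ⟨p, hp, hp'⟩ := hu3 T hT
    obtain ⟨q, hq, hq'⟩ := hv3 T hT
    exact ⟨p + q, (MvPolynomial.totalDegree_add p q).trans (max_le hp hq),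
      fun x hx => by simp [hp' x hx, hq' x hx]⟩
  zero_mem' := ⟨continuousOn_const, fun _ _ => rfl, fun _ _ => ⟨0, by simp, by simp⟩⟩
  smul_mem' := by
    rintro c u ⟨hu1, hu2, hu3⟩
    refine ⟨hu1.const_smul c, fun x hx => by simp [hu2 x hx], fun T hT => ?_⟩
    obtain ⟨p, hp, hp'⟩ := hu3 T hT
    exact ⟨c • p, (MvPolynomial.totalDegree_smul_le c p).trans hp,
      fun x hx => by simp [hp' x hx, MvPolynomial.smul_eval]⟩

lemma IsTestFunction.continuous_gradient {d : ℕ} {Ω : Set (EuclideanSpace ℝ (Fin d))}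
    {φ : EuclideanSpace ℝ (Fin d) → ℝ} (h : IsTestFunction Ω φ) : Continuous (gradient φ) :=
  (InnerProductSpace.toDual ℝ (EuclideanSpace ℝ (Fin d))).symm.continuous.comp
    (h.contDiff.continuous_fderiv (by simp))

lemma IsTestFunction.hasCompactSupport_gradient {d : ℕ} {Ω : Set (EuclideanSpace ℝ (Fin d))}
    {φ : EuclideanSpace ℝ (Fin d) → ℝ} (h : IsTestFunction Ω φ) :
    HasCompactSupport (gradient φ) :=
  (h.hasCompactSupport.fderiv (𝕜 := ℝ)).comp_left
    (g := (InnerProductSpace.toDual ℝ (EuclideanSpace ℝ (Fin d))).symm) (map_zero _)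

lemma IsTestFunction.memLp_two {d : ℕ} {Ω : Set (EuclideanSpace ℝ (Fin d))}
    {φ : EuclideanSpace ℝ (Fin d) → ℝ} (h : IsTestFunction Ω φ) :
    MemLp φ 2 (volume.restrict Ω) :=
  h.contDiff.continuous.memLp_of_hasCompactSupport h.hasCompactSupport

lemma IsTestFunction.memLp_two_gradient {d : ℕ} {Ω : Set (EuclideanSpace ℝ (Fin d))}
    {φ : EuclideanSpace ℝ (Fin d) → ℝ} (h : IsTestFunction Ω φ) :
    MemLp (gradient φ) 2 (volume.restrict Ω) :=
  h.continuous_gradient.memLp_of_hasCompactSupport h.hasCompactSupport_gradient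

lemma gradient_add_of_test {d : ℕ} {Ω : Set (EuclideanSpace ℝ (Fin d))}
    {φ ψ : EuclideanSpace ℝ (Fin d) → ℝ} (h : IsTestFunction Ω φ) (h' : IsTestFunction Ω ψ)
    (x : EuclideanSpace ℝ (Fin d)) :
    gradient (φ + ψ) x = gradient φ x + gradient ψ x := by
  unfold gradient
  rw [fderiv_add ((h.contDiff.differentiable (by simp)) x)
    ((h'.contDiff.differentiable (by simp)) x), map_add]

lemma gradient_smul_of_test {d : ℕ} {Ω : Set (EuclideanSpace ℝ (Fin d))}
    {φ : EuclideanSpace ℝ (Fin d) → ℝ} (h : IsTestFunction Ω φ) (c : ℝ)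
    (x : EuclideanSpace ℝ (Fin d)) :
    gradient (c • φ) x = c • gradient φ x := by
  unfold gradient
  rw [fderiv_const_smul ((h.contDiff.differentiable (by simp)) x)]
  simp

lemma IsTestFunction.add {d : ℕ} {Ω : Set (EuclideanSpace ℝ (Fin d))}
    {φ ψ : EuclideanSpace ℝ (Fin d) → ℝ} (h : IsTestFunction Ω φ) (h' : IsTestFunction Ω ψ) :
    IsTestFunction Ω (φ + ψ) where
  contDiff := h.contDiff.add h'.contDiff
  hasCompactSupport := h.hasCompactSupport.add h'.hasCompactSupport
  tsupport_subset := (tsupport_add φ ψ).trans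
    (Set.union_subset h.tsupport_subset h'.tsupport_subset)

lemma IsTestFunction.const_smul {d : ℕ} {Ω : Set (EuclideanSpace ℝ (Fin d))}
    {φ : EuclideanSpace ℝ (Fin d) → ℝ} (h : IsTestFunction Ω φ) (c : ℝ) :
    IsTestFunction Ω (c • φ) where
  contDiff := h.contDiff.const_smul c
  hasCompactSupport := h.hasCompactSupport.smul_left (f := fun _ => c)
  tsupport_subset := (tsupport_smul_subset_right (fun _ => c) φ).trans h.tsupport_subset

lemma HasWeakGradient.add {d : ℕ} {Ω : Set (EuclideanSpace ℝ (Fin d))}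
    {u v : EuclideanSpace ℝ (Fin d) → ℝ}
    {G H : EuclideanSpace ℝ (Fin d) → EuclideanSpace ℝ (Fin d)}
    (hu : HasWeakGradient Ω u G) (hv : HasWeakGradient Ω v H) :
    HasWeakGradient Ω (u + v) (G + H) where
  memLp := hu.memLp.add hv.memLp
  memLp_grad := hu.memLp_grad.add hv.memLp_grad
  integral_eq φ hφ := by
    have e1 := hu.integral_eq φ hφ
    have e2 := hv.integral_eq φ hφ
    have i1 : Integrable (fun x => u x • gradient φ x) (volume.restrict Ω) :=
      memLp_one_iff_integrable.1 (hφ.memLp_two_gradient.smul hu.memLp)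
    have i2 : Integrable (fun x => v x • gradient φ x) (volume.restrict Ω) :=
      memLp_one_iff_integrable.1 (hφ.memLp_two_gradient.smul hv.memLp)
    have i3 : Integrable (fun x => φ x • G x) (volume.restrict Ω) :=
      memLp_one_iff_integrable.1 (hu.memLp_grad.smul hφ.memLp_two)
    have i4 : Integrable (fun x => φ x • H x) (volume.restrict Ω) :=
      memLp_one_iff_integrable.1 (hv.memLp_grad.smul hφ.memLp_two)
    simp only [Pi.add_apply, add_smul, smul_add]
    rw [integral_add i1 i2, integral_add i3 i4, e1, e2, neg_add]

lemma HasWeakGradient.const_smul {d : ℕ} {Ω : Set (EuclideanSpace ℝ (Fin d))}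
    {u : EuclideanSpace ℝ (Fin d) → ℝ}
    {G : EuclideanSpace ℝ (Fin d) → EuclideanSpace ℝ (Fin d)}
    (hu : HasWeakGradient Ω u G) (c : ℝ) : HasWeakGradient Ω (c • u) (c • G) where
  memLp := hu.memLp.const_smul c
  memLp_grad := hu.memLp_grad.const_smul c
  integral_eq φ hφ := by
    have e1 := hu.integral_eq φ hφ
    simp only [Pi.smul_apply, smul_eq_mul, mul_smul, smul_comm _ c]
    rw [integral_smul, integral_smul, e1, smul_neg]

/-- `H¹₀(Ω)` as a linear space of functions. -/
def sobolevH10 {d : ℕ} (Ω : Set (EuclideanSpace ℝ (Fin d))) :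
    Submodule ℝ (EuclideanSpace ℝ (Fin d) → ℝ) where
  carrier := {u | MemH10 Ω u}
  add_mem' := by
    rintro u v ⟨G, hG, φ, hφ, hφ1, hφ2⟩ ⟨H, hH, ψ, hψ, hψ1, hψ2⟩
    refine ⟨G + H, hG.add hH, fun j => φ j + ψ j, fun j => (hφ j).add (hψ j), ?_, ?_⟩
    · refine tendsto_of_tendsto_of_tendsto_of_le_of_le tendsto_const_nhds
        (by simpa using hφ1.add hψ1) (fun _ => zero_le) (fun j => ?_)
      have e : (fun x => (φ j + ψ j) x - (u + v) x)
          = (fun x => φ j x - u x) + fun x => ψ j x - v x := by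
        ext x; simp only [Pi.add_apply]; ring
      rw [e]
      exact eLpNorm_add_le ((hφ j).memLp_two.sub hG.memLp).1
        ((hψ j).memLp_two.sub hH.memLp).1 (by norm_num)
    · refine tendsto_of_tendsto_of_tendsto_of_le_of_le tendsto_const_nhds
        (by simpa using hφ2.add hψ2) (fun _ => zero_le) (fun j => ?_)
      have e : (fun x => gradient (φ j + ψ j) x - (G + H) x)
          = (fun x => gradient (φ j) x - G x) + fun x => gradient (ψ j) x - H x := by
        ext1 x; simp only [Pi.add_apply, gradient_add_of_test (hφ j) (hψ j)]; abel
      rw [e]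
      exact eLpNorm_add_le ((hφ j).memLp_two_gradient.sub hG.memLp_grad).1
        ((hψ j).memLp_two_gradient.sub hH.memLp_grad).1 (by norm_num)
  zero_mem' := by
    have e : gradient (0 : EuclideanSpace ℝ (Fin d) → ℝ) = 0 := by
      ext1 x; simp [gradient]
    refine ⟨0, ⟨MemLp.zero, MemLp.zero, by simp⟩, fun _ => 0, fun _ => ?_, ?_, ?_⟩
    · exact ⟨contDiff_const, HasCompactSupport.zero, by simp [tsupport]⟩
    · simp
    · simp [e]
  smul_mem' := by
    rintro c u ⟨G, hG, φ, hφ, hφ1, hφ2⟩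
    refine ⟨c • G, hG.const_smul c, fun j => c • φ j, fun j => (hφ j).const_smul c, ?_, ?_⟩
    · have e : ∀ j, (fun x => (c • φ j) x - (c • u) x) = c • fun x => φ j x - u x := by
        intro j; ext x; simp only [Pi.smul_apply, smul_sub]
      simp only [e, eLpNorm_const_smul]
      simpa using ENNReal.Tendsto.const_mul hφ1 (Or.inr (by simp))
    · have e : ∀ j, (fun x => gradient (c • φ j) x - (c • G) x)
          = c • fun x => gradient (φ j) x - G x := by
        intro j; ext1 x
        simp only [Pi.smul_apply, smul_sub, gradient_smul_of_test (hφ j)]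
      simp only [e, eLpNorm_const_smul]
      simpa using ENNReal.Tendsto.const_mul hφ2 (Or.inr (by simp))

/-- The space `W = H¹₀(Ω) ∩ S⁰ₙ(△)`. -/
def splineH10 {d : ℕ} (K : Geometry.SimplicialComplex ℝ (EuclideanSpace ℝ (Fin d)))
    (Ω : Set (EuclideanSpace ℝ (Fin d))) (n : ℕ) :
    Submodule ℝ (EuclideanSpace ℝ (Fin d) → ℝ) :=
  sobolevH10 Ω ⊓ splineSpace K n

/-- The functions `B ξ` form a `1`-local family: each is supported in `star^1(T_ξ)` for some
simplex `T_ξ` of the partition. -/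
def IsOneLocal {d : ℕ} (K : Geometry.SimplicialComplex ℝ (EuclideanSpace ℝ (Fin d)))
    {ι : Type*} (B : ι → EuclideanSpace ℝ (Fin d) → ℝ) : Prop :=
  ∀ ξ, ∃ T ∈ simplices K, tsupport (B ξ) ⊆ starSet K {T} 1

/-- The Riesz bounds with constants `C₁`, `C₂` for the family `B` in the energy norm. -/
def RieszBounds {d : ℕ} (Ω : Set (EuclideanSpace ℝ (Fin d))) {ι : Type*} [Fintype ι]
    (B : ι → EuclideanSpace ℝ (Fin d) → ℝ) (C₁ C₂ : ℝ) : Prop :=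
  ∀ c : ι → ℝ, C₁ * ∑ ξ, |c ξ| ^ 2 ≤ energyNorm Ω (∑ ξ, c ξ • B ξ) ^ 2 ∧
    energyNorm Ω (∑ ξ, c ξ • B ξ) ^ 2 ≤ C₂ * ∑ ξ, |c ξ| ^ 2

end

/-!
Write `g = ∑ c ξ • B ξ` and let `S j` be the part of this sum over the `ξ` with
`T_ξ ∈ star^j(ω)`. If `j < k`, the summands of `S j` are admissible test functions, and they are
orthogonal to every `B η` with `T_η ∉ star^(j+2)(ω)`, so `⟨S (j + 2), S j⟩ = ⟨g, S j⟩ = 0`. By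
Pythagoras `‖S j‖ ≤ ‖S (j + 2) - S j‖`, which the Riesz bounds turn into
`C₁ * a j ≤ C₂ * (a (j + 2) - a j)` for the sums `a j` of the squared coefficients of `S j`: these
grow geometrically as long as `j < k`. Finally, only the summands of `S 1` are seen on `T ∈ ω`.
-/

open Module Submodule

section RieszSequences

variable {H ι : Type*} [SeminormedAddCommGroup H]

/-- A Riesz sequence with lower bound `C₁` and upper bound `C₂`. Only finite linear combinations
are tested, so that the index type may be infinite. -/
structure IsRieszSequence [NormedSpace ℝ H] (v : ι → H) (C₁ C₂ : ℝ) : Prop where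
  lower (s : Finset ι) (c : ι → ℝ) : C₁ * ∑ ξ ∈ s, c ξ ^ 2 ≤ ‖∑ ξ ∈ s, c ξ • v ξ‖ ^ 2
  upper (s : Finset ι) (c : ι → ℝ) : ‖∑ ξ ∈ s, c ξ • v ξ‖ ^ 2 ≤ C₂ * ∑ ξ ∈ s, c ξ ^ 2

namespace IsRieszSequence

lemma mono_upper [NormedSpace ℝ H] {v : ι → H} {C₁ C₂ C₂' : ℝ} (hv : IsRieszSequence v C₁ C₂)
    (hC : C₂ ≤ C₂') : IsRieszSequence v C₁ C₂' where
  lower := hv.lower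
  upper s c := (hv.upper s c).trans (by gcongr)

variable [InnerProductSpace ℝ H] {v : ι → H} {C₁ C₂ : ℝ}

lemma add_mul_sum_sq_le_of_inner_eq_zero (hv : IsRieszSequence v C₁ C₂) {c : ι → ℝ}
    {r s : Finset ι} (hrs : r ⊆ s)
    (horth : inner ℝ (∑ ξ ∈ s, c ξ • v ξ) (∑ ξ ∈ r, c ξ • v ξ) = 0) :
    (C₁ + C₂) * ∑ ξ ∈ r, c ξ ^ 2 ≤ C₂ * ∑ ξ ∈ s, c ξ ^ 2 := by
  classical
  have pythagoras := norm_sub_sq_eq_norm_sq_add_norm_sq_real horth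
  rw [← Finset.sum_sdiff_eq_sub hrs] at pythagoras
  have hannulus : C₁ * ∑ ξ ∈ r, c ξ ^ 2 ≤ C₂ * ∑ ξ ∈ s \ r, c ξ ^ 2 :=
    calc C₁ * ∑ ξ ∈ r, c ξ ^ 2 ≤ ‖∑ ξ ∈ r, c ξ • v ξ‖ ^ 2 := hv.lower r c
      _ ≤ ‖∑ ξ ∈ s \ r, c ξ • v ξ‖ ^ 2 := by
        nlinarith [mul_self_nonneg ‖∑ ξ ∈ s, c ξ • v ξ‖]
      _ ≤ C₂ * ∑ ξ ∈ s \ r, c ξ ^ 2 := hv.upper _ c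
  rw [Finset.sum_sdiff_eq_sub hrs] at hannulus
  linarith

lemma inner_partial_sums_eq_zero {c : ι → ℝ} {r s t : Finset ι} (hst : s ⊆ t)
    (hg : ∀ ξ ∈ r, inner ℝ (∑ η ∈ t, c η • v η) (v ξ) = 0)
    (hfar : ∀ ξ ∈ r, ∀ η ∈ t, η ∉ s → inner ℝ (v η) (v ξ) = 0) :
    inner ℝ (∑ η ∈ s, c η • v η) (∑ ξ ∈ r, c ξ • v ξ) = 0 := by
  rw [inner_sum]
  refine Finset.sum_eq_zero fun ξ hξ => ?_
  rw [inner_smul_right, sum_inner, Finset.sum_subset hst, ← sum_inner, hg ξ hξ, mul_zero]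
  intro η hη hηs
  rw [inner_smul_left, hfar ξ hξ η hη hηs, mul_zero]

lemma pow_mul_sum_sq_le (hv : IsRieszSequence v C₁ C₂) (hC₁ : 0 < C₁) (hC₂ : 0 < C₂)
    {c : ι → ℝ} {s : Finset ι} {M : ℕ → Finset ι} (hM : Monotone M) (hMs : ∀ j, M j ⊆ s) {k : ℕ}
    (hg : ∀ j < k, ∀ ξ ∈ M j, inner ℝ (∑ η ∈ s, c η • v η) (v ξ) = 0)
    (hfar : ∀ j, ∀ ξ ∈ M j, ∀ η ∈ s, η ∉ M (j + 2) → inner ℝ (v η) (v ξ) = 0)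
    {m : ℕ} (hm : 2 * m ≤ k) :
    (1 + C₁ / C₂) ^ m * ∑ ξ ∈ M 1, c ξ ^ 2 ≤ ∑ ξ ∈ M (2 * m + 1), c ξ ^ 2 := by
  refine geom_le (u := fun i => ∑ ξ ∈ M (2 * i + 1), c ξ ^ 2) (by positivity) m fun i hi => ?_
  have hstep := hv.add_mul_sum_sq_le_of_inner_eq_zero (hM (Nat.le_add_right (2 * i + 1) 2))
    (inner_partial_sums_eq_zero (hMs _) (hg (2 * i + 1) (by omega)) (hfar _))
  rw [one_add_div hC₂.ne', div_mul_eq_mul_div, div_le_iff₀' hC₂, add_comm C₂]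
  exact hstep

lemma pow_mul_norm_sq_le (hv : IsRieszSequence v C₁ C₂) (hC₁ : 0 < C₁) (hC₂ : 0 < C₂)
    {c : ι → ℝ} {s : Finset ι} {M : ℕ → Finset ι} (hM : Monotone M) (hMs : ∀ j, M j ⊆ s) {k : ℕ}
    (hg : ∀ j < k, ∀ ξ ∈ M j, inner ℝ (∑ η ∈ s, c η • v η) (v ξ) = 0)
    (hfar : ∀ j, ∀ ξ ∈ M j, ∀ η ∈ s, η ∉ M (j + 2) → inner ℝ (v η) (v ξ) = 0)
    {m : ℕ} (hm : 2 * m ≤ k) :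
    (1 + C₁ / C₂) ^ m * ‖∑ ξ ∈ M 1, c ξ • v ξ‖ ^ 2
      ≤ C₂ / C₁ * ‖∑ ξ ∈ s, c ξ • v ξ‖ ^ 2 := by
  have htotal : ∑ ξ ∈ s, c ξ ^ 2 ≤ ‖∑ ξ ∈ s, c ξ • v ξ‖ ^ 2 / C₁ :=
    (le_div_iff₀' hC₁).2 (hv.lower s c)
  calc (1 + C₁ / C₂) ^ m * ‖∑ ξ ∈ M 1, c ξ • v ξ‖ ^ 2
      ≤ (1 + C₁ / C₂) ^ m * (C₂ * ∑ ξ ∈ M 1, c ξ ^ 2) := by gcongr; exact hv.upper _ c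
    _ = C₂ * ((1 + C₁ / C₂) ^ m * ∑ ξ ∈ M 1, c ξ ^ 2) := by ring
    _ ≤ C₂ * ∑ ξ ∈ M (2 * m + 1), c ξ ^ 2 := by
      gcongr
      exact hv.pow_mul_sum_sq_le hC₁ hC₂ hM hMs hg hfar hm
    _ ≤ C₂ * ∑ ξ ∈ s, c ξ ^ 2 := by
      gcongr
      exact hMs _
    _ ≤ C₂ * (‖∑ ξ ∈ s, c ξ • v ξ‖ ^ 2 / C₁) := by gcongr
    _ = C₂ / C₁ * ‖∑ ξ ∈ s, c ξ • v ξ‖ ^ 2 := by ring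

end IsRieszSequence

end RieszSequences

section WeakGradients

variable {d : ℕ} {Ω : Set (EuclideanSpace ℝ (Fin d))}

lemma IsTestFunction.mono {U : Set (EuclideanSpace ℝ (Fin d))} (hU : U ⊆ Ω)
    {φ : EuclideanSpace ℝ (Fin d) → ℝ} (h : IsTestFunction U φ) : IsTestFunction Ω φ :=
  ⟨h.contDiff, h.hasCompactSupport, h.tsupport_subset.trans hU⟩

lemma ae_eq_zero_of_forall_isTestFunction {F : Type*} [NormedAddCommGroup F] [NormedSpace ℝ F]
    [CompleteSpace F] {U : Set (EuclideanSpace ℝ (Fin d))} (hU : IsOpen U) (hUΩ : U ⊆ Ω)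
    {G : EuclideanSpace ℝ (Fin d) → F} (hG : LocallyIntegrableOn G U)
    (h : ∀ φ, IsTestFunction U φ → ∫ x in Ω, φ x • G x = 0) :
    ∀ᵐ x, x ∈ U → G x = 0 := by
  refine hU.ae_eq_zero_of_integral_contDiff_smul_eq_zero hG fun φ hφ hφc hφU => ?_
  rw [← h φ ⟨hφ, hφc, hφU⟩, setIntegral_eq_integral_of_forall_compl_eq_zero]
  intro x hx
  rw [image_eq_zero_of_notMem_tsupport fun hxφ => hx (hUΩ (hφU hxφ)), zero_smul]

namespace HasWeakGradient

variable {u : EuclideanSpace ℝ (Fin d) → ℝ}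
  {G H : EuclideanSpace ℝ (Fin d) → EuclideanSpace ℝ (Fin d)}

lemma locallyIntegrableOn (hG : HasWeakGradient Ω u G) : LocallyIntegrableOn G Ω :=
  locallyIntegrableOn_of_locallyIntegrable_restrict
    (hG.memLp_grad.locallyIntegrable one_le_two)

lemma integrable_smul (hG : HasWeakGradient Ω u G) {φ : EuclideanSpace ℝ (Fin d) → ℝ}
    (hφ : IsTestFunction Ω φ) : IntegrableOn (fun x => φ x • G x) Ω :=
  memLp_one_iff_integrable.1 (hG.memLp_grad.smul hφ.memLp_two)

protected lemma ae_eq (hΩ : IsOpen Ω) (hG : HasWeakGradient Ω u G)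
    (hH : HasWeakGradient Ω u H) : G =ᵐ[volume.restrict Ω] H := by
  have hsub := ae_eq_zero_of_forall_isTestFunction hΩ subset_rfl
    (hG.locallyIntegrableOn.sub hH.locallyIntegrableOn) fun φ hφ => by
      simp only [Pi.sub_apply, smul_sub]
      rw [integral_sub (hG.integrable_smul hφ) (hH.integrable_smul hφ), sub_eq_zero, ← neg_inj,
        ← hG.integral_eq φ hφ, hH.integral_eq φ hφ]
  filter_upwards [(ae_restrict_iff' hΩ.measurableSet).2 hsub] with x hx
  exact sub_eq_zero.1 hx

lemma ae_eq_zero_of_notMem_tsupport (hΩ : IsOpen Ω) (hG : HasWeakGradient Ω u G) :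
    ∀ᵐ x ∂(volume.restrict Ω), x ∉ tsupport u → G x = 0 := by
  have hzero := ae_eq_zero_of_forall_isTestFunction (hΩ.sdiff (isClosed_tsupport u))
    Set.sdiff_subset (hG.locallyIntegrableOn.mono_set Set.sdiff_subset) fun φ hφ => by
      rw [← neg_eq_zero, ← hG.integral_eq φ (hφ.mono Set.sdiff_subset)]
      refine integral_eq_zero_of_ae (ae_of_all _ fun x => ?_)
      by_cases hx : x ∈ tsupport u
      · have hφx : fderiv ℝ φ x = 0 := image_eq_zero_of_notMem_tsupport fun h =>
          (hφ.tsupport_subset (tsupport_fderiv_subset ℝ h)).2 hx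
        simp [gradient, hφx]
      · simp [image_eq_zero_of_notMem_tsupport hx]
  rw [ae_restrict_iff' hΩ.measurableSet]
  filter_upwards [hzero] with x hx hxΩ hxu
  exact hx ⟨hxΩ, hxu⟩

end HasWeakGradient

lemma MemH10.hasWeakGradient {u : EuclideanSpace ℝ (Fin d) → ℝ} (hu : MemH10 Ω u) :
    HasWeakGradient Ω u (weakGradient Ω u) := by
  have h : ∃ G, HasWeakGradient Ω u G := hu.imp fun _ => And.left
  rw [weakGradient, dif_pos h]
  exact h.choose_spec

/-- The weak gradient as a linear map from `H¹₀(Ω)` to `L²(Ω)`. It turns the energy inner product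
into that of `L²(Ω)`. -/
noncomputable def gradLp (hΩ : IsOpen Ω) :
    sobolevH10 Ω →ₗ[ℝ] Lp (EuclideanSpace ℝ (Fin d)) 2 (volume.restrict Ω) where
  toFun u := (MemH10.hasWeakGradient u.2).memLp_grad.toLp _
  map_add' u v := by
    rw [← MemLp.toLp_add, MemLp.toLp_eq_toLp_iff]
    exact (MemH10.hasWeakGradient (u + v).2).ae_eq hΩ
      ((MemH10.hasWeakGradient u.2).add (MemH10.hasWeakGradient v.2))
  map_smul' c u := by
    rw [RingHom.id_apply, ← MemLp.toLp_const_smul, MemLp.toLp_eq_toLp_iff]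
    exact (MemH10.hasWeakGradient (c • u).2).ae_eq hΩ
      ((MemH10.hasWeakGradient u.2).const_smul c)

/-- The restriction of the weak gradient to `A`, as a linear map from `H¹₀(Ω)` to `L²(Ω ∩ A)`. -/
noncomputable def gradLpOn (hΩ : IsOpen Ω) (A : Set (EuclideanSpace ℝ (Fin d))) :
    sobolevH10 Ω →ₗ[ℝ] Lp (EuclideanSpace ℝ (Fin d)) 2 ((volume.restrict Ω).restrict A) :=
  (LpToLpRestrictCLM _ _ ℝ (volume.restrict Ω) 2 A).toLinearMap ∘ₗ gradLp hΩ

variable {u v : sobolevH10 Ω} {A : Set (EuclideanSpace ℝ (Fin d))}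

lemma coeFn_gradLp (hΩ : IsOpen Ω) (u : sobolevH10 Ω) :
    gradLp hΩ u =ᵐ[volume.restrict Ω] weakGradient Ω (u : EuclideanSpace ℝ (Fin d) → ℝ) :=
  MemLp.coeFn_toLp (MemH10.hasWeakGradient u.2).memLp_grad

lemma coeFn_gradLpOn (hΩ : IsOpen Ω) (u : sobolevH10 Ω) :
    gradLpOn hΩ A u =ᵐ[(volume.restrict Ω).restrict A]
      weakGradient Ω (u : EuclideanSpace ℝ (Fin d) → ℝ) :=
  (LpToLpRestrictCLM_coeFn ℝ A _).trans (ae_restrict_of_ae (coeFn_gradLp hΩ u))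

lemma inner_gradLp (hΩ : IsOpen Ω) (u v : sobolevH10 Ω) :
    inner ℝ (gradLp hΩ u) (gradLp hΩ v) = energyInner Ω u v := by
  rw [L2.inner_def, energyInner]
  refine integral_congr_ae ?_
  filter_upwards [coeFn_gradLp hΩ u, coeFn_gradLp hΩ v] with x hu hv
  rw [hu, hv]

lemma norm_gradLp (hΩ : IsOpen Ω) (u : sobolevH10 Ω) : ‖gradLp hΩ u‖ = energyNorm Ω u := by
  rw [energyNorm, ← inner_gradLp hΩ, real_inner_self_eq_norm_sq, Real.sqrt_sq (norm_nonneg _)]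

lemma norm_gradLpOn (hΩ : IsOpen Ω) (hA : MeasurableSet A) (u : sobolevH10 Ω) :
    ‖gradLpOn hΩ A u‖ = energyNormOn Ω A u := by
  have hindicator : (fun x => ‖A.indicator (weakGradient Ω u) x‖ ^ 2) =
      A.indicator fun x => ‖weakGradient Ω u x‖ ^ 2 := by
    ext x
    by_cases hx : x ∈ A <;> simp [hx]
  rw [energyNormOn, hindicator, integral_indicator hA,
    ← Real.sqrt_sq (norm_nonneg (gradLpOn hΩ A u)), ← real_inner_self_eq_norm_sq, L2.inner_def]
  congr 1
  refine integral_congr_ae ?_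
  filter_upwards [coeFn_gradLpOn hΩ u] with x hx
  rw [hx, real_inner_self_eq_norm_sq]

lemma norm_gradLpOn_le (hΩ : IsOpen Ω) (u : sobolevH10 Ω) : ‖gradLpOn hΩ A u‖ ≤ ‖gradLp hΩ u‖ :=
  norm_Lp_toLp_restrict_le A (gradLp hΩ u)

lemma gradLpOn_eq_zero_of_volume_inter_eq_zero (hΩ : IsOpen Ω)
    (h : volume (tsupport (u : EuclideanSpace ℝ (Fin d) → ℝ) ∩ A) = 0) (hA : MeasurableSet A) :
    gradLpOn hΩ A u = 0 := by
  rw [Lp.eq_zero_iff_ae_eq_zero]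
  filter_upwards [coeFn_gradLpOn hΩ u, ae_restrict_mem hA,
    ae_restrict_of_ae (ae_restrict_of_ae (measure_eq_zero_iff_ae_notMem.1 h)),
    ae_restrict_of_ae ((MemH10.hasWeakGradient u.2).ae_eq_zero_of_notMem_tsupport hΩ)]
    with x hx hxA hxuA hxu
  rw [hx, hxu fun h => hxuA ⟨h, hxA⟩, Pi.zero_apply]

lemma energyInner_eq_zero_of_volume_inter_eq_zero (hΩ : IsOpen Ω)
    (h : volume (tsupport (u : EuclideanSpace ℝ (Fin d) → ℝ) ∩
      tsupport (v : EuclideanSpace ℝ (Fin d) → ℝ)) = 0) :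
    energyInner Ω u v = 0 := by
  refine integral_eq_zero_of_ae ?_
  filter_upwards [ae_restrict_of_ae (measure_eq_zero_iff_ae_notMem.1 h),
    (MemH10.hasWeakGradient u.2).ae_eq_zero_of_notMem_tsupport hΩ,
    (MemH10.hasWeakGradient v.2).ae_eq_zero_of_notMem_tsupport hΩ] with x hx hu hv
  by_cases hxu : x ∈ tsupport (u : EuclideanSpace ℝ (Fin d) → ℝ)
  · simp [hv fun hxv => hx ⟨hxu, hxv⟩]
  · simp [hu hxu]

end WeakGradients

section Simplices

lemma addHaar_convexHull_eq_zero_iff_card_ne {E : Type*} [NormedAddCommGroup E] [NormedSpace ℝ E]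
    [FiniteDimensional ℝ E] [MeasurableSpace E] [BorelSpace E] (μ : Measure E)
    [μ.IsAddHaarMeasure] {S : Finset E} (hS : AffineIndependent ℝ ((↑) : S → E)) :
    μ (convexHull ℝ (S : Set E)) = 0 ↔ S.card ≠ finrank ℝ E + 1 := by
  have hspan : affineSpan ℝ (S : Set E) = ⊤ ↔ S.card = finrank ℝ E + 1 := by
    simpa using hS.affineSpan_eq_top_iff_card_eq_finrank_add_one
  rw [Ne, ← hspan]
  refine ⟨fun hnull htop => ?_, fun h => measure_mono_null (convexHull_subset_affineSpan _)
    (Measure.addHaar_affineSubspace μ _ h)⟩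
  exact (Measure.measure_pos_of_nonempty_interior μ
    (interior_convexHull_nonempty_iff_affineSpan_eq_top.2 htop)).ne' hnull

variable {d : ℕ} {K : Geometry.SimplicialComplex ℝ (EuclideanSpace ℝ (Fin d))}
  {S T : Finset (EuclideanSpace ℝ (Fin d))}

lemma simplexSet_nonempty (hT : T ∈ simplices K) : (simplexSet T).Nonempty :=
  convexHull_nonempty_iff.2 (Geometry.SimplicialComplex.nonempty_of_mem_faces hT.1)

lemma measurableSet_simplexSet (T : Finset (EuclideanSpace ℝ (Fin d))) :
    MeasurableSet (simplexSet T) :=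
  (T.finite_toSet.isCompact_convexHull (𝕜 := ℝ)).isClosed.measurableSet

lemma volume_simplexSet_pos (hT : T ∈ simplices K) : 0 < volume (simplexSet T) := by
  rw [pos_iff_ne_zero, simplexSet, Ne, addHaar_convexHull_eq_zero_iff_card_ne _ (K.indep hT.1)]
  simpa using hT.2

lemma volume_simplexSet_inter_eq_zero (hS : S ∈ simplices K) (hT : T ∈ simplices K)
    (hST : S ≠ T) : volume (simplexSet S ∩ simplexSet T) = 0 := by
  classical
  have hcard : (S ∩ T).card ≠ d + 1 := fun h => hST <|
    (Finset.eq_of_subset_of_card_le Finset.inter_subset_left (by rw [h, hS.2])).symm.trans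
      (Finset.eq_of_subset_of_card_le Finset.inter_subset_right (by rw [h, hT.2]))
  rw [simplexSet, simplexSet, Geometry.SimplicialComplex.convexHull_inter_convexHull hS.1 hT.1,
    ← Finset.coe_inter, addHaar_convexHull_eq_zero_iff_card_ne]
  · simpa using hcard
  · exact (K.indep hS.1).mono (t := (S : Set _))
      (Finset.coe_subset.2 Finset.inter_subset_left)

lemma countable_simplices (K : Geometry.SimplicialComplex ℝ (EuclideanSpace ℝ (Fin d))) :
    (simplices K).Countable := by
  have h := Measure.countable_meas_pos_of_disjoint_iUnion₀ (μ := volume)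
    (As := fun T : simplices K => simplexSet T.1)
    (fun T => (measurableSet_simplexSet T.1).nullMeasurableSet)
    fun S T hST => volume_simplexSet_inter_eq_zero S.2 T.2 (Subtype.coe_ne_coe.2 hST)
  simp only [volume_simplexSet_pos (Subtype.coe_prop _), Set.ofPred_true] at h
  exact Set.countable_coe_iff.1 (Set.countable_univ_iff.1 h)

lemma volume_biUnion_simplexSet_inter_eq_zero
    {P Q : Set (Finset (EuclideanSpace ℝ (Fin d)))} (hP : P ⊆ simplices K) (hQ : Q ⊆ simplices K)
    (hPQ : Disjoint P Q) :
    volume ((⋃ S ∈ P, simplexSet S) ∩ ⋃ T ∈ Q, simplexSet T) = 0 := by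
  simp only [Set.iUnion₂_inter, Set.inter_iUnion₂]
  refine (measure_biUnion_null_iff ((countable_simplices K).mono hQ)).2 fun T hT =>
    (measure_biUnion_null_iff ((countable_simplices K).mono hP)).2 fun S hS =>
      volume_simplexSet_inter_eq_zero (hP hS) (hQ hT) (hPQ.ne_of_mem hS hT)

end Simplices

section Stars

variable {d : ℕ} {K : Geometry.SimplicialComplex ℝ (EuclideanSpace ℝ (Fin d))}
  {ω : Set (Finset (EuclideanSpace ℝ (Fin d)))} {S T : Finset (EuclideanSpace ℝ (Fin d))}

lemma starCluster_subset_simplices (hω : ω ⊆ simplices K) :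
    ∀ k, starCluster K ω k ⊆ simplices K
  | 0 => hω
  | _ + 1 => fun _ hT => hT.1

lemma monotone_starCluster (hω : ω ⊆ simplices K) : Monotone (starCluster K ω) := by
  refine monotone_nat_of_le_succ fun k T hT => ?_
  have h := starCluster_subset_simplices hω k hT
  exact ⟨h, T, hT, by simpa using simplexSet_nonempty h⟩

lemma starCluster_singleton_one_subset {j : ℕ} (hT : T ∈ starCluster K ω j) :
    starCluster K {T} 1 ⊆ starCluster K ω (j + 1) := by
  rintro S ⟨hS, _, rfl, hne⟩
  exact ⟨hS, _, hT, hne⟩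

lemma starSet_singleton_one_subset {j k : ℕ} (hω : ω ⊆ simplices K)
    (hT : T ∈ starCluster K ω j) (hjk : j < k) : starSet K {T} 1 ⊆ starSet K ω k :=
  Set.biUnion_subset_biUnion_left <|
    (starCluster_singleton_one_subset hT).trans (monotone_starCluster hω hjk)

lemma mem_starCluster_singleton_one_symm (hT : T ∈ simplices K)
    (h : S ∈ starCluster K {T} 1) : T ∈ starCluster K {S} 1 := by
  obtain ⟨-, _, rfl, hne⟩ := h
  exact ⟨hT, S, rfl, Set.inter_comm _ _ ▸ hne⟩

lemma disjoint_starCluster_singleton_one {j : ℕ} (hS : S ∈ starCluster K ω j)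
    (hT : T ∈ simplices K) (hTω : T ∉ starCluster K ω (j + 2)) :
    Disjoint (starCluster K {S} 1) (starCluster K {T} 1) :=
  Set.disjoint_left.2 fun _ hRS hRT => hTω <|
    starCluster_singleton_one_subset (starCluster_singleton_one_subset hS hRS)
      (mem_starCluster_singleton_one_symm hT hRT)

lemma volume_starSet_singleton_one_inter_eq_zero {j : ℕ}
    (hS : S ∈ starCluster K ω j) (hT : T ∈ simplices K) (hTω : T ∉ starCluster K ω (j + 2)) :
    volume (starSet K {S} 1 ∩ starSet K {T} 1) = 0 :=
  volume_biUnion_simplexSet_inter_eq_zero (fun _ h => h.1) (fun _ h => h.1)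
    (disjoint_starCluster_singleton_one hS hT hTω)

lemma volume_starSet_singleton_one_inter_simplexSet_eq_zero (hS : S ∈ simplices K)
    (hω : ω ⊆ simplices K) (hSω : S ∉ starCluster K ω 1) (hT : T ∈ ω) :
    volume (starSet K {S} 1 ∩ simplexSet T) = 0 := by
  have h := volume_biUnion_simplexSet_inter_eq_zero (P := starCluster K {S} 1) (Q := {T})
    (fun _ h => h.1) (Set.singleton_subset_iff.2 (hω hT)) <|
      Set.disjoint_singleton_right.2 fun hTS => hSω <|
        starCluster_singleton_one_subset (j := 0) hT (mem_starCluster_singleton_one_symm hS hTS)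
  rwa [Set.biUnion_singleton] at h

end Stars

section Decay

variable {d : ℕ} {Ω : Set (EuclideanSpace ℝ (Fin d))}
  {K : Geometry.SimplicialComplex ℝ (EuclideanSpace ℝ (Fin d))} {ι : Type*}

open Classical in
lemma norm_gradLpOn_sum_le (hΩ : IsOpen Ω) {B : ι → sobolevH10 Ω}
    {τ : ι → Finset (EuclideanSpace ℝ (Fin d))} (hτ : ∀ ξ, τ ξ ∈ simplices K)
    (hsupp : ∀ ξ, tsupport (B ξ : EuclideanSpace ℝ (Fin d) → ℝ) ⊆ starSet K {τ ξ} 1)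
    {ω : Set (Finset (EuclideanSpace ℝ (Fin d)))} (hω : ω ⊆ simplices K)
    {T : Finset (EuclideanSpace ℝ (Fin d))} (hT : T ∈ ω) (s : Finset ι) (c : ι → ℝ) :
    ‖gradLpOn hΩ (simplexSet T) (∑ ξ ∈ s, c ξ • B ξ)‖ ≤
      ‖gradLp hΩ (∑ ξ ∈ s with τ ξ ∈ starCluster K ω 1, c ξ • B ξ)‖ := by
  have hvanish : ∀ ξ ∈ s, ξ ∉ s.filter (τ · ∈ starCluster K ω 1) →
      gradLpOn hΩ (simplexSet T) (c ξ • B ξ) = 0 := fun ξ hξ hξ' => by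
    have hτω : τ ξ ∉ starCluster K ω 1 := fun h => hξ' (Finset.mem_filter.2 ⟨hξ, h⟩)
    rw [map_smul, gradLpOn_eq_zero_of_volume_inter_eq_zero hΩ
      (measure_mono_null (Set.inter_subset_inter_left _ (hsupp ξ))
        (volume_starSet_singleton_one_inter_simplexSet_eq_zero (hτ ξ) hω hτω hT))
      (measurableSet_simplexSet T), smul_zero]
  rw [map_sum, ← Finset.sum_subset (Finset.filter_subset _ s) hvanish, ← map_sum]
  exact norm_gradLpOn_le hΩ _

lemma pow_mul_sq_energyNormOn_le (hΩ : IsOpen Ω) {B : ι → sobolevH10 Ω} {C₁ C₂ : ℝ}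
    (hC₁ : 0 < C₁) (hC₂ : 0 < C₂)
    (hloc : IsOneLocal K fun ξ => (B ξ : EuclideanSpace ℝ (Fin d) → ℝ))
    (hB : IsRieszSequence (fun ξ => gradLp hΩ (B ξ)) C₁ C₂)
    {ω : Set (Finset (EuclideanSpace ℝ (Fin d)))} (hω : ω ⊆ simplices K)
    {T : Finset (EuclideanSpace ℝ (Fin d))} (hT : T ∈ ω) {k m : ℕ} (hm : 2 * m ≤ k)
    {g : sobolevH10 Ω} (hg : g ∈ span ℝ (Set.range B))
    (horth : ∀ ξ, tsupport (B ξ : EuclideanSpace ℝ (Fin d) → ℝ) ⊆ starSet K ω k →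
      energyInner Ω g (B ξ) = 0) :
    (1 + C₁ / C₂) ^ m * energyNormOn Ω (simplexSet T) g ^ 2
      ≤ C₂ / C₁ * energyNorm Ω g ^ 2 := by
  classical
  choose τ hτ hsupp using hloc
  obtain ⟨c, rfl⟩ := Finsupp.mem_span_range_iff_exists_finsupp.1 hg
  rw [Finsupp.sum] at horth ⊢
  have hgrad (s : Finset ι) : gradLp hΩ (∑ ξ ∈ s, c ξ • B ξ) = ∑ ξ ∈ s, c ξ • gradLp hΩ (B ξ) := by
    simp only [map_sum, map_smul]
  have hM : Monotone fun j => c.support.filter (τ · ∈ starCluster K ω j) := fun i j hij =>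
    Finset.monotone_filter_right _ fun _ _ h => monotone_starCluster hω hij h
  have hgB : ∀ j < k, ∀ ξ ∈ c.support.filter (τ · ∈ starCluster K ω j),
      inner ℝ (∑ η ∈ c.support, c η • gradLp hΩ (B η)) (gradLp hΩ (B ξ)) = 0 :=
    fun j hj ξ hξ => by
      rw [← hgrad, inner_gradLp]
      exact horth ξ ((hsupp ξ).trans
        (starSet_singleton_one_subset hω (Finset.mem_filter.1 hξ).2 hj))
  have hfar : ∀ j, ∀ ξ ∈ c.support.filter (τ · ∈ starCluster K ω j), ∀ η ∈ c.support,
      η ∉ c.support.filter (τ · ∈ starCluster K ω (j + 2)) →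
      inner ℝ (gradLp hΩ (B η)) (gradLp hΩ (B ξ)) = 0 := fun j ξ hξ η hη hη' => by
    have hτω : τ η ∉ starCluster K ω (j + 2) := fun h => hη' (Finset.mem_filter.2 ⟨hη, h⟩)
    rw [real_inner_comm, inner_gradLp]
    exact energyInner_eq_zero_of_volume_inter_eq_zero hΩ <|
      measure_mono_null (Set.inter_subset_inter (hsupp ξ) (hsupp η)) <|
        volume_starSet_singleton_one_inter_eq_zero (Finset.mem_filter.1 hξ).2 (hτ η) hτω
  rw [← norm_gradLpOn hΩ (measurableSet_simplexSet T), ← norm_gradLp hΩ, hgrad]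
  refine le_trans ?_
    (hB.pow_mul_norm_sq_le hC₁ hC₂ hM (fun _ => Finset.filter_subset _ _) hgB hfar hm)
  rw [← hgrad]
  gcongr
  exact norm_gradLpOn_sum_le hΩ hτ hsupp hω hT _ _

lemma sq_energyNormOn_le (hΩ : IsOpen Ω) {B : ι → sobolevH10 Ω} {C₁ C₂ : ℝ}
    (hC₁ : 0 < C₁) (hC₂ : 0 < C₂)
    (hloc : IsOneLocal K fun ξ => (B ξ : EuclideanSpace ℝ (Fin d) → ℝ))
    (hB : IsRieszSequence (fun ξ => gradLp hΩ (B ξ)) C₁ C₂)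
    {ω : Set (Finset (EuclideanSpace ℝ (Fin d)))} (hω : ω ⊆ simplices K)
    {T : Finset (EuclideanSpace ℝ (Fin d))} (hT : T ∈ ω) {k : ℕ}
    {g : sobolevH10 Ω} (hg : g ∈ span ℝ (Set.range B))
    (horth : ∀ ξ, tsupport (B ξ : EuclideanSpace ℝ (Fin d) → ℝ) ⊆ starSet K ω k →
      energyInner Ω g (B ξ) = 0) :
    energyNormOn Ω (simplexSet T) g ^ 2
      ≤ (1 + C₂ / C₁) * (C₂ / (C₁ + C₂)) ^ (k / 2 + 1) * energyNorm Ω g ^ 2 := by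
  have hq : C₂ / (C₁ + C₂) * (1 + C₁ / C₂) = 1 := by
    field_simp
    ring
  have hr : C₂ / C₁ = (1 + C₂ / C₁) * (C₂ / (C₁ + C₂)) := by
    field_simp
  calc energyNormOn Ω (simplexSet T) g ^ 2
      = (C₂ / (C₁ + C₂)) ^ (k / 2) *
          ((1 + C₁ / C₂) ^ (k / 2) * energyNormOn Ω (simplexSet T) g ^ 2) := by
        rw [← mul_assoc, ← mul_pow, hq, one_pow, one_mul]
    _ ≤ (C₂ / (C₁ + C₂)) ^ (k / 2) * (C₂ / C₁ * energyNorm Ω g ^ 2) :=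
        mul_le_mul_of_nonneg_left (pow_mul_sq_energyNormOn_le hΩ hC₁ hC₂ hloc hB hω hT
          (Nat.mul_div_le k 2) hg horth) (by positivity)
    _ = (1 + C₂ / C₁) * (C₂ / (C₁ + C₂)) ^ (k / 2 + 1) * energyNorm Ω g ^ 2 := by
        linear_combination (C₂ / (C₁ + C₂)) ^ (k / 2) * energyNorm Ω g ^ 2 * hr

end Decay

lemma exists_pow_half_succ_le_sq_pow {q : ℝ} (hq : 0 < q) (hq1 : q < 1) :
    ∃ σ : ℝ, 0 < σ ∧ σ < 1 ∧ ∀ k : ℕ, q ^ (k / 2 + 1) ≤ (σ ^ k) ^ 2 := by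
  -- The fourth root of `q` works because `2 * k ≤ 4 * (k / 2 + 1)`.
  refine ⟨q ^ ((4 : ℕ) : ℝ)⁻¹, by positivity, Real.rpow_lt_one hq.le hq1 (by positivity),
    fun k => ?_⟩
  have hσ1 : q ^ ((4 : ℕ) : ℝ)⁻¹ ≤ 1 := (Real.rpow_lt_one hq.le hq1 (by positivity)).le
  conv_lhs => rw [← Real.rpow_inv_natCast_pow hq.le four_ne_zero]
  rw [← pow_mul, ← pow_mul]
  exact pow_le_pow_of_le_one (by positivity) hσ1 (by omega)

lemma RieszBounds.isRieszSequence_gradLp {d : ℕ} {Ω : Set (EuclideanSpace ℝ (Fin d))}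
    (hΩ : IsOpen Ω) {ι : Type*} [Fintype ι] {B : ι → sobolevH10 Ω} {C₁ C₂ : ℝ}
    (h : RieszBounds Ω (fun ξ => (B ξ : EuclideanSpace ℝ (Fin d) → ℝ)) C₁ C₂) :
    IsRieszSequence (fun ξ => gradLp hΩ (B ξ)) C₁ C₂ := by
  classical
  have hbounds (s : Finset ι) (c : ι → ℝ) :
      C₁ * ∑ ξ ∈ s, c ξ ^ 2 ≤ ‖∑ ξ ∈ s, c ξ • gradLp hΩ (B ξ)‖ ^ 2 ∧
        ‖∑ ξ ∈ s, c ξ • gradLp hΩ (B ξ)‖ ^ 2 ≤ C₂ * ∑ ξ ∈ s, c ξ ^ 2 := by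
    have hs := h fun ξ => if ξ ∈ s then c ξ else 0
    simp only [sq_abs, ite_smul, zero_smul, ite_pow, ne_eq, OfNat.ofNat_ne_zero, not_false_eq_true,
      zero_pow, Finset.sum_ite_mem, Finset.univ_inter] at hs
    have hnorm : ‖∑ ξ ∈ s, c ξ • gradLp hΩ (B ξ)‖ =
        energyNorm Ω (∑ ξ ∈ s, c ξ • (B ξ : EuclideanSpace ℝ (Fin d) → ℝ)) := by
      simp only [← map_smul, ← map_sum, norm_gradLp, coe_sum, coe_smul]
    rwa [hnorm]
  exact ⟨fun s c => (hbounds s c).1, fun s c => (hbounds s c).2⟩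

lemma splineH10_le_sobolevH10 {d : ℕ} (K : Geometry.SimplicialComplex ℝ (EuclideanSpace ℝ (Fin d)))
    (Ω : Set (EuclideanSpace ℝ (Fin d))) (n : ℕ) : splineH10 K Ω n ≤ sobolevH10 Ω :=
  inf_le_left

lemma inclusion_mem_span_range_basis {R M ι : Type*} [Semiring R] [AddCommMonoid M] [Module R M]
    {p q : Submodule R M} (h : p ≤ q) (b : Basis ι R p) (x : p) :
    inclusion h x ∈ span R (Set.range fun i => inclusion h (b i)) := by
  rw [Set.range_comp' (inclusion h) b, ← map_span, b.span_eq]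
  exact mem_map_of_mem mem_top

theorem mainTheorem4_general (ρ : ℝ) :
    ∃ σ C : ℝ, 0 < σ ∧ σ < 1 ∧ 0 < C ∧
      ∀ (d : ℕ) (Ω : Set (EuclideanSpace ℝ (Fin d)))
        (K : Geometry.SimplicialComplex ℝ (EuclideanSpace ℝ (Fin d))) (hΩ : IsOpen Ω)
        (ι : Type*) (B : ι → sobolevH10 Ω) (C₁ C₂ : ℝ), 0 < C₁ → C₂ ≤ ρ * C₁ →
        IsOneLocal K (fun ξ => (B ξ : EuclideanSpace ℝ (Fin d) → ℝ)) →
        IsRieszSequence (fun ξ => gradLp hΩ (B ξ)) C₁ C₂ →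
      ∀ ω ⊆ simplices K, ∀ T ∈ ω, ∀ k : ℕ, ∀ g ∈ span ℝ (Set.range B),
        (∀ ξ, tsupport (B ξ : EuclideanSpace ℝ (Fin d) → ℝ) ⊆ starSet K ω k →
          energyInner Ω g (B ξ) = 0) →
        energyNormOn Ω (simplexSet T) g ≤ C * σ ^ k * energyNorm Ω g := by
  have hr : 0 < max ρ 1 := lt_max_of_lt_right one_pos
  generalize hρr : max ρ 1 = r at hr
  obtain ⟨σ, hσ, hσ1, hpow⟩ := exists_pow_half_succ_le_sq_pow (q := r / (1 + r)) (by positivity)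
    ((div_lt_one (by positivity)).2 (lt_one_add r))
  refine ⟨σ, √(1 + r), hσ, hσ1, by positivity, fun d Ω K hΩ ι B C₁ C₂ hC₁ hρ hloc hB ω hω T hT k
    g hg horth => le_of_sq_le_sq ?_ (mul_nonneg (by positivity) (Real.sqrt_nonneg _))⟩
  have hC₂ : C₂ ≤ r * C₁ := hρ.trans (by gcongr; exact hρr ▸ le_max_left ρ 1)
  have hdecay := sq_energyNormOn_le hΩ hC₁ (mul_pos hr hC₁) hloc (hB.mono_upper hC₂) hω hT hg horth
  have hrate : r * C₁ / (C₁ + r * C₁) = r / (1 + r) := by field_simp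
  rw [hrate, mul_div_cancel_right₀ _ hC₁.ne'] at hdecay
  rw [mul_pow, mul_pow, Real.sq_sqrt (by positivity)]
  exact hdecay.trans (by gcongr; exact hpow k)

theorem mainTheorem4 :
    ∀ ρ : ℝ, ∃ σ C : ℝ, 0 < σ ∧ σ < 1 ∧ 0 < C ∧
      ∀ (d : ℕ), 2 ≤ d →
      ∀ (Ω : Set (EuclideanSpace ℝ (Fin d)))
        (K : Geometry.SimplicialComplex ℝ (EuclideanSpace ℝ (Fin d))),
        IsSimplicialPartition K Ω →
      ∀ (n : ℕ), 1 ≤ n →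
      ∀ (ι : Type*) [Fintype ι] (B : Module.Basis ι ℝ (splineH10 K Ω n)) (C₁ C₂ : ℝ),
        0 < C₁ → 0 < C₂ → C₂ / C₁ = ρ →
        IsOneLocal K (fun ξ => (B ξ : EuclideanSpace ℝ (Fin d) → ℝ)) →
        RieszBounds Ω (fun ξ => (B ξ : EuclideanSpace ℝ (Fin d) → ℝ)) C₁ C₂ →
      ∀ (ω : Set (Finset (EuclideanSpace ℝ (Fin d)))), ω ⊆ simplices K →
      ∀ T ∈ ω, ∀ k : ℕ, 1 ≤ k →
      ∀ g ∈ splineH10 K Ω n,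
        (∀ w ∈ splineH10 K Ω n, tsupport w ⊆ starSet K ω k → energyInner Ω g w = 0) →
        energyNormOn Ω (simplexSet T) g ≤ C * σ ^ k * energyNorm Ω g := by
  intro ρ
  obtain ⟨σ, C, hσ, hσ1, hC, hdecay⟩ := mainTheorem4_general ρ
  refine ⟨σ, C, hσ, hσ1, hC, fun d _ Ω K hK n _ ι _ B C₁ C₂ hC₁ _ hρ hloc hB ω hω T hT k _ g hg
    horth => ?_⟩
  have hle := splineH10_le_sobolevH10 K Ω n
  have hriesz := RieszBounds.isRieszSequence_gradLp (B := fun ξ => inclusion hle (B ξ)) hK.isOpen hB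
  exact hdecay d Ω K hK.isOpen ι _ C₁ C₂ hC₁ ((div_le_iff₀ hC₁).1 hρ.le) hloc hriesz ω hω T hT k
    (inclusion hle ⟨g, hg⟩) (inclusion_mem_span_range_basis hle B _) fun ξ => horth _ (B ξ).2
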